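/- A $k$-CNF formula is a finite set of clauses, each of which is a disjunction of exactly $k$ literals on $k$ distinct variables. Two distinct clauses of a formula $\mathcal F$ are neighbors if they have a common variable (negated or not). The neighborhood of a clause $C$ in $\mathcal F$ is the set of clauses of $\mathcal F$ that are neighbors of $C$ (so $C$ itself is not counted), and the maximum neighborhood size of $\mathcal F$ is the maximum number of neighbors of a clause of $\mathcal F$ (it is $0$ if $\mathcal F$ is empty). For $k\ge 1$ let $l(k)$ denote the largest integer such that every $k$-CNF formula with maximum neighborhood size at most $l(k)$ is satisfiable. Then $l(k)$ is well defined for every $k \ge 1$, and (i) $l(k) \le 2^{k-1} - 1$ for every sufficiently large $k$ that is a power of $2$ (that is, there is $K$ such that this holds for every power of two $k \ge K$), and (ii) $l(k) \le 2^{k-1} + 2^{k-2}$ for every $k \ge 3$. -/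

import Mathlib

/-- Literals over the variables `x₀, x₁, …`: `(i, true)` is `xᵢ` and `(i, false)` is its negation. -/
abbrev Lit := ℕ × Bool

/-- A clause is the disjunction of a finite set of literals. -/
abbrev Clause := Finset Lit

/-- A formula in conjunctive normal form is the conjunction of a finite set of clauses. -/
abbrev CNF := Finset Clause

/-- The set of variables occurring in a clause, negated or not. -/
def Clause.vars (C : Clause) : Finset ℕ := C.image Prod.fst

/-- The assignment `a` satisfies `F`: every clause has a literal that is true under `a`. -/
def CNF.SatisfiedBy (F : CNF) (a : ℕ → Bool) : Prop :=
  ∀ C ∈ F, ∃ p ∈ C, a p.1 = p.2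

/-- `F` is satisfiable. -/
def CNF.Satisfiable (F : CNF) : Prop := ∃ a : ℕ → Bool, F.SatisfiedBy a

/-- `F` is a `k`-CNF formula: every clause has exactly `k` literals, on `k` distinct variables
(no clause contains a variable together with its negation). -/
def CNF.IsKCNF (k : ℕ) (F : CNF) : Prop :=
  ∀ C ∈ F, C.card = k ∧ (Clause.vars C).card = k

/-- The neighborhood of the clause `C` in `F`: the other clauses of `F` that have a variable in
common with `C`. -/
def CNF.neighborhood (F : CNF) (C : Clause) : Finset Clause :=
  F.filter (fun D => D ≠ C ∧ (Clause.vars C ∩ Clause.vars D).Nonempty)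

/-- The maximum neighborhood size of `F` (`0` for the empty formula). -/
def CNF.maxNeighborhoodSize (F : CNF) : ℕ :=
  F.sup (fun C => (F.neighborhood C).card)

/-- The integers `d` such that every `k`-CNF formula with maximum neighborhood size at most `d` is
satisfiable. -/
def satNeighborhoodBounds (k : ℕ) : Set ℕ :=
  {d | ∀ F : CNF, F.IsKCNF k → F.maxNeighborhoodSize ≤ d → F.Satisfiable}

/-- The largest integer `l(k)` such that every `k`-CNF formula with maximum neighborhood size at
most `l(k)` is satisfiable. -/
noncomputable def maxSatNeighborhood (k : ℕ) : ℕ := sSup (satNeighborhoodBounds k)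

/-! A full binary tree whose leaves all have depth at least `k` gives an unsatisfiable `k`-CNF:
inner nodes are variables, and each leaf carries the clause of the last `k` directions on its path.
Walking against an assignment reaches a leaf whose clause is false. Two clauses can share a variable
only if both leaves are within `k` steps of where their paths part, so a leaf's neighbors are
counted by the shallow leaves of the subtrees hanging off its last `k` steps. Hence a `Balanced k B`
tree gives `l(k) < B`.

For (ii), an explicit three-level tree has `B = 3 * 2 ^ (k - 2)`. For (i), with `k = 2 ^ m` and `d =
2 ^ (k - 1 - m)`, it is enough that every subtree has at most `d` leaves of depth less than `k`,
since `k * d = 2 ^ (k - 1)`.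

Such a tree is described by the depths of its shallow leaves. Passing to two equal children halves
these leaves and frees half of the budget, which is refilled with leaves at depth `k - 1` that the
parent no longer sees (`Constructible.of_halving`). After many halvings the accumulated groups, of
varied sizes, are distributed over subtrees so that few groups fill each one. How few suffice
depends on their sizes; a finite table of such numbers is improved repeatedly until no initial group
is needed. -/

/-! ### Binary trees and counting near leaves. -/

/-- Full binary trees without labels. -/
inductive BinTree
  | leaf : BinTree
  | node : BinTree → BinTree → BinTree

namespace BinTree

/-- The addresses of the leaves below the node with address `s`; the address of a node lists the
directions on the path from the root to it, the last one first. -/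
def leaves : List Bool → BinTree → Finset (List Bool)
  | s, leaf => {s}
  | s, node x y => leaves (false :: s) x ∪ leaves (true :: s) y

/-- The number of leaves of depth less than `k`. -/
def shallow : ℕ → BinTree → ℕ
  | 0, _ => 0
  | _ + 1, leaf => 1
  | k + 1, node x y => shallow k x + shallow k y

/-- Every leaf lies at depth at least `k`, and for every leaf the numbers of shallow leaves in the
subtrees hanging off the last `k` steps of the path to it add up to at most `B`. Here `l` lists
these numbers for the path to the root of the given subtree, the last one first. -/
def Balanced (k B : ℕ) : List ℕ → BinTree → Prop
  | l, leaf => k ≤ l.length ∧ (l.take k).sum ≤ B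
  | l, node x y => Balanced k B (y.shallow k :: l) x ∧ Balanced k B (x.shallow k :: l) y

theorem suffix_of_mem_leaves {T : BinTree} {s p : List Bool} (h : p ∈ leaves s T) : s <:+ p := by
  induction T generalizing s with
  | leaf => simp_all [leaves]
  | node x y hx hy =>
    simp only [leaves, Finset.mem_union] at h
    rcases h with h | h
    · exact (List.suffix_cons _ _).trans (hx h)
    · exact (List.suffix_cons _ _).trans (hy h)

theorem card_filter_leaves_le (T : BinTree) (s : List Bool) (k : ℕ) :
    ((leaves s T).filter fun q => q.length < s.length + k).card ≤ T.shallow k := by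
  induction T generalizing s k with
  | leaf =>
    cases k with
    | zero => simp [leaves, shallow, Finset.filter_singleton]
    | succ k => simpa [leaves, shallow] using Finset.card_filter_le {s} _
  | node x y hx hy =>
    cases k with
    | zero =>
      simp only [shallow, Nat.le_zero, Finset.card_eq_zero, Finset.filter_eq_empty_iff]
      intro q hq
      have := (suffix_of_mem_leaves hq).length_le
      omega
    | succ k =>
      simp only [leaves, shallow, Finset.filter_union]
      refine (Finset.card_union_le _ _).trans (add_le_add ?_ ?_)
      · simpa [add_assoc, add_comm 1 k] using hx (false :: s) k
      · simpa [add_assoc, add_comm 1 k] using hy (true :: s) k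

/-- Two leaf addresses are near if the last `k` branchings on the paths to them have a node in
common. -/
def Near (k : ℕ) (p q : List Bool) : Prop :=
  ∃ i < k, ∃ j < k, p.drop (i + 1) = q.drop (j + 1)

theorem Near.symm {k : ℕ} {p q : List Bool} (h : Near k p q) : Near k q p := by
  obtain ⟨i, hi, j, hj, e⟩ := h
  exact ⟨j, hj, i, hi, e.symm⟩

/-- Paths that part at `s` share no node below `s`, so a common node among the last `k` branchings
forces the window of `p` to reach up to `s`. -/
theorem Near.length_le {k : ℕ} {p q s : List Bool} {b c : Bool} (hbc : b ≠ c)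
    (hp : (b :: s) <:+ p) (hq : (c :: s) <:+ q) (h : Near k p q) :
    p.length ≤ s.length + k := by
  obtain ⟨i, hi, j, hj, e⟩ := h
  by_contra hlt
  have hlen : s.length + 1 ≤ (p.drop (i + 1)).length := by
    rw [List.length_drop]; omega
  have h1 : (b :: s) <:+ p.drop (i + 1) :=
    List.suffix_of_suffix_length_le hp (List.drop_suffix _ _) (by simpa using hlen)
  have h2 : (c :: s) <:+ p.drop (i + 1) :=
    List.suffix_of_suffix_length_le hq (e ▸ List.drop_suffix _ _) (by simpa using hlen)
  have h3 : (b :: s) <:+ (c :: s) := List.suffix_of_suffix_length_le h1 h2 (by simp)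
  have h4 := h3.eq_of_length (by simp)
  simp_all

-- The window of `p` covers only the lowest `k + s.length - p.length` ancestors above `s`, so only
-- those entries of `l` matter. Descending one step adds the sibling subtree, whose near leaves are
-- shallow, and lengthens the window by one entry.
open Classical in
theorem card_near_le_of_sibling {k : ℕ} {p s : List Bool} {b c : Bool} (hbc : b ≠ c)
    (hp : (b :: s) <:+ p) (T : BinTree) (l : List ℕ) (O : Finset (List Bool))
    (hO : ∀ p : List Bool, s <:+ p →
      (O.filter (Near k p)).card ≤ (l.take (k + s.length - p.length)).sum) :
    ((O ∪ leaves (c :: s) T).filter (Near k p)).card ≤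
      ((T.shallow k :: l).take (k + (b :: s).length - p.length)).sum := by
  have h1 := hO p ((List.suffix_cons _ _).trans hp)
  have hlen := hp.length_le
  rw [Finset.filter_union]
  refine (Finset.card_union_le _ _).trans ?_
  by_cases hk : p.length ≤ s.length + k
  · have e : k + (b :: s).length - p.length = (k + s.length - p.length) + 1 := by
      simp only [List.length_cons]; omega
    rw [e, List.take_succ_cons, List.sum_cons, add_comm]
    refine add_le_add ?_ h1
    refine (Finset.card_le_card ?_).trans (card_filter_leaves_le T (c :: s) k)
    intro q hq
    rw [Finset.mem_filter] at hq ⊢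
    have := hq.2.symm.length_le hbc.symm (suffix_of_mem_leaves hq.1) hp
    exact ⟨hq.1, by simp only [List.length_cons]; omega⟩
  · have h2 : (leaves (c :: s) T).filter (Near k p) = ∅ := by
      rw [Finset.filter_eq_empty_iff]
      intro q hq hn
      exact hk (hn.length_le hbc hp (suffix_of_mem_leaves hq))
    have e : k + s.length - p.length = 0 := by omega
    rw [e] at h1
    rw [h2]
    simp only [List.take_zero, List.sum_nil] at h1
    simp only [Finset.card_empty]
    omega

open Classical in
theorem Balanced.card_near_le {k B : ℕ} {T : BinTree} {l : List ℕ} (hT : Balanced k B l T)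
    {s : List Bool} (O : Finset (List Bool))
    (hO : ∀ p : List Bool, s <:+ p →
      (O.filter (Near k p)).card ≤ (l.take (k + s.length - p.length)).sum)
    {p : List Bool} (hp : p ∈ leaves s T) :
    ((O ∪ leaves s T).filter fun q => q ≠ p ∧ Near k p q).card ≤ B := by
  induction T generalizing l s O with
  | leaf =>
    simp only [leaves, Finset.mem_singleton] at hp
    subst hp
    have h1 := hO p List.suffix_rfl
    rw [Nat.add_sub_cancel] at h1
    refine (Finset.card_le_card ?_).trans (h1.trans hT.2)
    intro q hq
    simp only [leaves, Finset.mem_filter, Finset.mem_union, Finset.mem_singleton] at hq ⊢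
    tauto
  | node x y hx hy =>
    simp only [leaves, Finset.mem_union] at hp
    rcases hp with hp | hp
    · have := hx hT.1 (O ∪ leaves (true :: s) y)
        (fun p hp => card_near_le_of_sibling (by simp) hp y l O hO) hp
      rwa [Finset.union_assoc, Finset.union_comm (leaves (true :: s) y)] at this
    · have := hy hT.2 (O ∪ leaves (false :: s) x)
        (fun p hp => card_near_le_of_sibling (by simp) hp x l O hO) hp
      rwa [Finset.union_assoc] at this

theorem Balanced.le_length {k B : ℕ} {T : BinTree} {l : List ℕ} (hT : Balanced k B l T)
    {s p : List Bool} (hs : l.length = s.length) (hp : p ∈ leaves s T) : k ≤ p.length := by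
  induction T generalizing l s with
  | leaf =>
    simp only [leaves, Finset.mem_singleton] at hp
    subst hp
    exact hs ▸ hT.1
  | node x y hx hy =>
    simp only [leaves, Finset.mem_union] at hp
    rcases hp with hp | hp
    · exact hx hT.1 (by simp [hs]) hp
    · exact hy hT.2 (by simp [hs]) hp

/-! ### The formula of a tree. -/

/-- The clause of a leaf: the variables are the last `k` branching nodes on the path to it, and the
literal of a node is true if its variable has the value of the direction taken on the path. -/
def clauseAt (k : ℕ) (p : List Bool) : Clause :=
  (Finset.range k).image fun i => (Encodable.encode (p.drop (i + 1)), p.getD i false)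

/-- The formula with one clause for every leaf. -/
def toCNF (k : ℕ) (T : BinTree) : CNF := (leaves [] T).image (clauseAt k)

theorem vars_clauseAt (k : ℕ) (p : List Bool) :
    Clause.vars (clauseAt k p) =
      (Finset.range k).image fun i => Encodable.encode (p.drop (i + 1)) := by
  simp only [Clause.vars, clauseAt, Finset.image_image]
  rfl

theorem isKCNF_toCNF {k : ℕ} {T : BinTree} (h : ∀ p ∈ leaves [] T, k ≤ p.length) :
    (T.toCNF k).IsKCNF k := by
  intro C hC
  obtain ⟨p, hp, rfl⟩ := Finset.mem_image.1 hC
  have hk := h p hp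
  have hv : (Clause.vars (clauseAt k p)).card = k := by
    rw [vars_clauseAt, Finset.card_image_of_injOn, Finset.card_range]
    intro i hi j hj hij
    simp only [Finset.coe_range, Set.mem_Iio] at hi hj
    have := congrArg List.length (Encodable.encode_injective hij)
    simp only [List.length_drop] at this
    omega
  refine ⟨le_antisymm ?_ ?_, hv⟩
  · exact Finset.card_image_le.trans (Finset.card_range k).le
  · exact hv.symm.le.trans Finset.card_image_le

/-- At every node, take the direction opposite to the value of its variable. -/
theorem exists_leaf_forall_ne (a : ℕ → Bool) (T : BinTree) (s : List Bool)
    (hs : ∀ i < s.length, a (Encodable.encode (s.drop (i + 1))) ≠ s.getD i false) :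
    ∃ p ∈ leaves s T,
      ∀ i < p.length, a (Encodable.encode (p.drop (i + 1))) ≠ p.getD i false := by
  induction T generalizing s with
  | leaf => exact ⟨s, by simp [leaves], hs⟩
  | node x y hx hy =>
    have key : ∀ b, a (Encodable.encode s) ≠ b → ∀ i < (b :: s).length,
        a (Encodable.encode ((b :: s).drop (i + 1))) ≠ (b :: s).getD i false := by
      rintro b hb (_ | i) hi
      · simpa using hb
      · simpa using hs i (by simpa using hi)
    cases hb : a (Encodable.encode s) with
    | true =>
      obtain ⟨p, hp, h⟩ := hx _ (key false (by simp [hb]))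
      exact ⟨p, by simp [leaves, hp], h⟩
    | false =>
      obtain ⟨p, hp, h⟩ := hy _ (key true (by simp [hb]))
      exact ⟨p, by simp [leaves, hp], h⟩

theorem not_satisfiable_toCNF {k : ℕ} {T : BinTree} (h : ∀ p ∈ leaves [] T, k ≤ p.length) :
    ¬ (T.toCNF k).Satisfiable := by
  rintro ⟨a, ha⟩
  obtain ⟨p, hp, hpa⟩ := exists_leaf_forall_ne a T [] (by simp)
  obtain ⟨v, hv, hva⟩ := ha _ (Finset.mem_image_of_mem _ hp)
  obtain ⟨i, hi, rfl⟩ := Finset.mem_image.1 hv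
  exact hpa i ((Finset.mem_range.1 hi).trans_le (h p hp)) hva

theorem Balanced.maxNeighborhoodSize_le {k B : ℕ} {T : BinTree} (hT : Balanced k B [] T) :
    (T.toCNF k).maxNeighborhoodSize ≤ B := by
  classical
  refine Finset.sup_le fun C hC => ?_
  obtain ⟨p, hp, rfl⟩ := Finset.mem_image.1 hC
  have h := hT.card_near_le (s := []) ∅ (by simp) hp
  rw [Finset.empty_union] at h
  refine (Finset.card_le_card (t := ((leaves [] T).filter
    fun q => q ≠ p ∧ Near k p q).image (clauseAt k)) ?_).trans (Finset.card_image_le.trans h)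
  intro C hC
  obtain ⟨hC, hne, v, hv⟩ := Finset.mem_filter.1 hC
  obtain ⟨q, hq, rfl⟩ := Finset.mem_image.1 hC
  rw [Finset.mem_inter, vars_clauseAt, vars_clauseAt] at hv
  obtain ⟨i, hi, hiv⟩ := Finset.mem_image.1 hv.1
  obtain ⟨j, hj, hjv⟩ := Finset.mem_image.1 hv.2
  refine Finset.mem_image_of_mem _ (Finset.mem_filter.2 ⟨hq, ?_, ?_⟩)
  · rintro rfl
    exact hne rfl
  · exact ⟨i, Finset.mem_range.1 hi, j, Finset.mem_range.1 hj,
      Encodable.encode_injective (hiv.trans hjv.symm)⟩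

/-! ### Complete trees. -/

/-- The complete binary tree of depth `n` with a copy of `T` in place of every leaf. -/
def complete : ℕ → BinTree → BinTree
  | 0, T => T
  | n + 1, T => node (complete n T) (complete n T)

theorem shallow_complete_add (n j : ℕ) (T : BinTree) :
    (complete n T).shallow (n + j) = 2 ^ n * T.shallow j := by
  induction n with
  | zero => simp [complete]
  | succ n ih =>
    rw [show n + 1 + j = (n + j) + 1 by omega]
    simp only [complete, shallow, ih]
    ring

theorem shallow_complete_of_le {n j : ℕ} (h : j ≤ n) (T : BinTree) :
    (complete n T).shallow j = 0 := by
  induction n generalizing j with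
  | zero => simp [Nat.le_zero.1 h, shallow]
  | succ n ih =>
    cases j with
    | zero => simp [shallow]
    | succ j => simp [complete, shallow, ih (Nat.le_of_succ_le_succ h)]

theorem length_of_mem_leaves_complete {n : ℕ} {s p : List Bool}
    (hp : p ∈ leaves s (complete n leaf)) : p.length = s.length + n := by
  induction n generalizing s with
  | zero => simp_all [complete, leaves]
  | succ n ih =>
    simp only [complete, leaves, Finset.mem_union] at hp
    rcases hp with hp | hp <;> rw [ih hp, List.length_cons] <;> omega

theorem Balanced.complete {k B n : ℕ} {T : BinTree} {l : List ℕ}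
    (hs : ∀ i < n, (T.complete i).shallow k = 2 ^ i)
    (h : Balanced k B ((List.range n).map (2 ^ ·) ++ l) T) :
    Balanced k B l (BinTree.complete n T) := by
  induction n generalizing l with
  | zero => simpa [BinTree.complete] using h
  | succ n ih =>
    have h1 : Balanced k B (2 ^ n :: l) (BinTree.complete n T) := by
      refine ih (fun i hi => hs i (hi.trans n.lt_succ_self)) ?_
      simpa [List.range_succ] using h
    have h2 := hs n n.lt_succ_self
    exact ⟨by rwa [h2], by rwa [h2]⟩

end BinTree

/-! ### Well-definedness of `l(k)`. -/

theorem zero_mem_satNeighborhoodBounds {k : ℕ} (hk : 1 ≤ k) : 0 ∈ satNeighborhoodBounds k := by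
  classical
  intro F hF h0
  have hdisj : ∀ C ∈ F, ∀ D ∈ F, (Clause.vars C ∩ Clause.vars D).Nonempty → D = C := by
    intro C hC D hD hCD
    by_contra hne
    have h1 : (F.neighborhood C).card ≤ 0 :=
      (Finset.le_sup (f := fun C => (F.neighborhood C).card) hC).trans h0
    have h2 : D ∈ F.neighborhood C := Finset.mem_filter.2 ⟨hD, hne, hCD⟩
    rw [Finset.card_eq_zero.1 (Nat.le_zero.1 h1)] at h2
    simp at h2
  have hne : ∀ C ∈ F, ∃ v b, (v, b) ∈ C := by
    intro C hC
    obtain ⟨⟨v, b⟩, h⟩ := Finset.card_pos.1 (hk.trans (hF C hC).1.ge)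
    exact ⟨v, b, h⟩
  choose! v b hvb using hne
  -- Distinct clauses share no variables, so the chosen literals can all be made true at once.
  refine ⟨fun x => decide (∃ C ∈ F, v C = x ∧ b C = true), fun C hC => ⟨_, hvb C hC, ?_⟩⟩
  have hmem : ∀ C ∈ F, v C ∈ Clause.vars C := fun C hC =>
    Finset.mem_image_of_mem Prod.fst (hvb C hC)
  have : (∃ D ∈ F, v D = v C ∧ b D = true) ↔ b C = true := by
    constructor
    · rintro ⟨D, hD, hv, hb⟩
      have := hdisj C hC D hD ⟨v C, Finset.mem_inter.2 ⟨hmem C hC, hv ▸ hmem D hD⟩⟩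
      rwa [← this]
    · exact fun h => ⟨C, hC, rfl, h⟩
  simp [this]

theorem lt_of_mem_satNeighborhoodBounds {k d : ℕ} {F : CNF} (hd : d ∈ satNeighborhoodBounds k)
    (hF : F.IsKCNF k) (hsat : ¬ F.Satisfiable) : d < F.maxNeighborhoodSize := by
  by_contra h
  exact hsat (hd F hF (not_lt.1 h))

theorem isGreatest_maxSatNeighborhood {k : ℕ} (hk : 1 ≤ k) :
    IsGreatest (satNeighborhoodBounds k) (maxSatNeighborhood k) := by
  have hlen : ∀ p ∈ BinTree.leaves [] (BinTree.complete k .leaf), k ≤ p.length := fun p hp => by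
    simp [BinTree.length_of_mem_leaves_complete hp]
  -- The complete tree of depth `k` supplies an unsatisfiable formula.
  have hbdd : BddAbove (satNeighborhoodBounds k) :=
    ⟨_, fun d hd => (lt_of_mem_satNeighborhoodBounds hd (BinTree.isKCNF_toCNF hlen)
      (BinTree.not_satisfiable_toCNF hlen)).le⟩
  exact ⟨Nat.sSup_mem ⟨0, zero_mem_satNeighborhoodBounds hk⟩ hbdd, fun d hd => le_csSup hbdd hd⟩

theorem BinTree.Balanced.maxSatNeighborhood_lt {k B : ℕ} (hk : 1 ≤ k) {T : BinTree}
    (hT : T.Balanced k B []) : maxSatNeighborhood k < B := by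
  have hlen : ∀ p ∈ BinTree.leaves [] T, k ≤ p.length := fun p hp => hT.le_length rfl hp
  exact (lt_of_mem_satNeighborhoodBounds (isGreatest_maxSatNeighborhood hk).1
    (BinTree.isKCNF_toCNF hlen) (BinTree.not_satisfiable_toCNF hlen)).trans_le
    hT.maxNeighborhoodSize_le

/-! ### The three-level tree for (ii). -/

namespace BinTree

theorem sum_map_range_two_pow (n : ℕ) : ((List.range n).map (2 ^ ·)).sum + 1 = 2 ^ n := by
  induction n with
  | zero => simp
  | succ n ih => simp only [List.range_succ, List.map_append, List.sum_append, List.map_cons,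
      List.map_nil, List.sum_cons, List.sum_nil, pow_succ]; omega

theorem shallow_complete_node_leaf {k i : ℕ} (hi : i + 2 ≤ k) {T : BinTree}
    (hT : T.shallow (k - i - 1) = 0) : (complete i (node leaf T)).shallow k = 2 ^ i := by
  obtain ⟨r, rfl⟩ := Nat.exists_eq_add_of_le hi
  have e : i + 2 + r - i - 1 = r + 1 := by omega
  rw [e] at hT
  rw [show i + 2 + r = i + (r + 2) by omega, shallow_complete_add]
  simp [shallow, hT]

theorem shallow_complete_leaf {k i : ℕ} (hi : i < k) : (complete i leaf).shallow k = 2 ^ i := by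
  obtain ⟨r, rfl⟩ := Nat.exists_eq_add_of_lt hi
  rw [add_assoc, shallow_complete_add]
  simp [shallow]

/-- With `k = n + 2`, the windows of the three kinds of leaves sum to `2 ^ n + (2 ^ (n + 1) - 1)`,
`2 ^ (n + 1) + (2 ^ n - 1) + 1` and `(2 ^ (n + 1) - 1) + 1`, from the top level down. The second is
exactly the bound. -/
theorem balanced_three_levels (n : ℕ) :
    Balanced (n + 2) (3 * 2 ^ n) []
      (complete (n + 1) (node leaf (complete n (node leaf (complete (n + 1) leaf))))) := by
  have h0 := sum_map_range_two_pow n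
  have h1 := sum_map_range_two_pow (n + 1)
  have hp : 2 ^ (n + 1) = 2 * 2 ^ n := pow_succ' 2 n
  have hC : (complete (n + 1) leaf).shallow (n + 2) = 2 ^ (n + 1) :=
    shallow_complete_leaf (Nat.lt_succ_self _)
  have hB : (complete n (node leaf (complete (n + 1) leaf))).shallow (n + 2) = 2 ^ n :=
    shallow_complete_node_leaf le_rfl (shallow_complete_of_le (by omega) _)
  have hleaf : leaf.shallow (n + 2) = 1 := rfl
  refine Balanced.complete (fun i hi => shallow_complete_node_leaf (by omega) ?_) ⟨⟨?_, ?_⟩, ?_⟩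
  · rcases i with _ | i
    · rw [show n + 2 - 0 - 1 = n + 1 from rfl, shallow_complete_add]
      simp [shallow]
    · exact shallow_complete_of_le (by omega) _
  · simp
  · rw [hB, List.take_of_length_le (by simp)]
    simp only [List.append_nil, List.sum_cons]
    omega
  rw [hleaf]
  refine Balanced.complete (fun i hi => shallow_complete_node_leaf (by omega)
    (shallow_complete_of_le (by omega) _)) ⟨⟨?_, ?_⟩, ?_⟩
  · simp
  · rw [hC, List.append_cons, ← List.cons_append, List.take_append_of_le_length (by simp),
      List.take_of_length_le (by simp)]
    simp only [List.sum_append, List.sum_cons, List.sum_nil]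
    omega
  rw [hleaf]
  refine Balanced.complete (fun i hi => shallow_complete_leaf (by omega)) ⟨?_, ?_⟩
  · simp only [List.length_append, List.length_cons, List.length_map, List.length_range]
    omega
  · rw [List.append_cons, List.take_append_of_le_length (by simp),
      List.take_of_length_le (by simp)]
    simp only [List.sum_append, List.sum_cons, List.sum_nil]
    omega

end BinTree

/-! ### Sparse trees and constructible depth multisets. -/

namespace BinTree

/-- Every subtree has at most `d` leaves of depth less than `k`. -/
def Sparse (k d : ℕ) : BinTree → Prop
  | leaf => shallow k leaf ≤ d
  | node x y => shallow k (node x y) ≤ d ∧ Sparse k d x ∧ Sparse k d y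

/-- The multiset of the depths of the leaves. -/
def depths : BinTree → Multiset ℕ
  | leaf => {0}
  | node x y => (depths x + depths y).map (· + 1)

theorem card_filter_depths (T : BinTree) (k : ℕ) :
    (T.depths.filter (· < k)).card = T.shallow k := by
  induction T generalizing k with
  | leaf => cases k <;> simp [depths, shallow, Multiset.filter_singleton]
  | node x y hx hy =>
    cases k with
    | zero => simp [shallow]
    | succ k =>
      simp only [depths, shallow, Multiset.filter_map, Multiset.card_map, Multiset.filter_add,
        Multiset.card_add, ← hx, ← hy, Function.comp_def, Nat.add_lt_add_iff_right]

theorem Sparse.shallow_le {k d : ℕ} {T : BinTree} (h : T.Sparse k d) : T.shallow k ≤ d := by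
  cases T with
  | leaf => exact h
  | node x y => exact h.1

theorem Sparse.balanced {k d : ℕ} {T : BinTree} (h : T.Sparse k d) (l : List ℕ)
    (hl : ∀ x ∈ l, x ≤ d) (hT : ∀ i ∈ T.depths, k ≤ i + l.length) : T.Balanced k (k * d) l := by
  induction T generalizing l with
  | leaf =>
    refine ⟨by simpa [depths] using hT, ?_⟩
    refine (List.sum_le_card_nsmul _ d fun x hx => hl x (List.mem_of_mem_take hx)).trans ?_
    rw [smul_eq_mul]
    exact Nat.mul_le_mul_right _ (by simp)
  | node x y hx hy =>
    have hT' : ∀ i ∈ x.depths + y.depths, k ≤ i + (l.length + 1) := fun i hi => by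
      have := hT (i + 1) (Multiset.mem_map_of_mem (· + 1) hi)
      omega
    refine ⟨hx h.2.1 _ ?_ fun i hi => hT' i (Multiset.mem_add.2 (.inl hi)),
      hy h.2.2 _ ?_ fun i hi => hT' i (Multiset.mem_add.2 (.inr hi))⟩
    · simpa using ⟨h.2.2.shallow_le, hl⟩
    · simpa using ⟨h.2.1.shallow_le, hl⟩

end BinTree

open BinTree

/-- There is a sparse binary tree whose leaves of depth less than `k` have depths in `X`,
counted with multiplicity. -/
def Constructible (k d : ℕ) (X : Multiset ℕ) : Prop :=
  ∃ T : BinTree, T.Sparse k d ∧ T.depths.filter (· < k) ≤ X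

namespace Constructible

variable {k d : ℕ} {X Y Z : Multiset ℕ}

theorem mono (h : Constructible k d X) (hXY : X ≤ Y) : Constructible k d Y := by
  obtain ⟨T, hT, hX⟩ := h
  exact ⟨T, hT, hX.trans hXY⟩

theorem singleton_zero (hd : 1 ≤ d) : Constructible k d {0} := by
  refine ⟨leaf, ?_, Multiset.filter_le _ _⟩
  cases k with
  | zero => exact Nat.zero_le _
  | succ k => exact hd

theorem of_children (hY : Constructible k d Y) (hZ : Constructible k d Z)
    (h : ((Y + Z).map (· + 1)).filter (· < k) ≤ X) (hX : X.card ≤ d) : Constructible k d X := by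
  obtain ⟨S, hS, hSY⟩ := hY
  obtain ⟨T, hT, hTZ⟩ := hZ
  have key : (node S T).depths.filter (· < k) ≤ X := by
    refine le_trans ?_ h
    have h1 : (node S T).depths.filter (· < k) =
        (((S.depths.filter (· < k) + T.depths.filter (· < k)).map (· + 1))).filter (· < k) := by
      simp only [depths, Multiset.filter_map, Multiset.filter_add, Multiset.filter_filter,
        Function.comp_def]
      congr 2 <;>
      · refine Multiset.filter_congr fun i _ => ?_
        omega
    rw [h1]
    exact Multiset.filter_le_filter _ (Multiset.map_le_map (add_le_add hSY hTZ))
  refine ⟨node S T, ⟨?_, hS, hT⟩, key⟩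
  rw [← card_filter_depths]
  exact (Multiset.card_le_card key).trans hX

theorem of_split (hY : Constructible k d Y) (hZ : Constructible k d Z)
    (h : (Y + Z).map (· + 1) ≤ X) (hX : X.card ≤ d) : Constructible k d X :=
  of_children hY hZ ((Multiset.filter_le _ _).trans h) hX

theorem of_list {t : ℕ} (Ys : List (Multiset ℕ)) (hlen : 2 ^ t ≤ Ys.length)
    (hYs : ∀ Y ∈ Ys, Constructible k d Y) (h : Ys.sum.map (· + t) ≤ X) (hX : X.card ≤ d) :
    Constructible k d X := by
  induction t generalizing Ys X with
  | zero =>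
    obtain _ | ⟨Y, Ys⟩ := Ys
    · simp at hlen
    · refine (hYs Y (by simp)).mono (le_trans ?_ h)
      simp
  | succ t ih =>
    have hsplit : (((Ys.take (2 ^ t)).sum.map (· + t) + (Ys.drop (2 ^ t)).sum.map (· + t)).map
        (· + 1)) ≤ X := by
      rwa [← Multiset.map_add, ← List.sum_append, List.take_append_drop, Multiset.map_map]
    have hcard : ((Ys.take (2 ^ t)).sum.map (· + t)).card +
        ((Ys.drop (2 ^ t)).sum.map (· + t)).card ≤ d := by
      have := (Multiset.card_le_card hsplit).trans hX
      rwa [Multiset.card_map, Multiset.card_add] at this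
    rw [pow_succ] at hlen
    refine of_split (ih (Ys.take (2 ^ t)) ?_ (fun Y hY => hYs Y (List.mem_of_mem_take hY)) le_rfl
      (by omega)) (ih (Ys.drop (2 ^ t)) ?_ (fun Y hY => hYs Y (List.mem_of_mem_drop hY)) le_rfl
      (by omega)) hsplit hX
    · rw [List.length_take]; omega
    · rw [List.length_drop]; omega

/-- A Kraft-type packing: a tree of `Ys` hung at depth `t` fills `2 ^ u` of the `2 ^ (t + u)` slots
at depth `t + u`, and a tree of `Zs` fills one. Surplus trees are dropped. -/
theorem of_two_lists {t u : ℕ} (Ys Zs : List (Multiset ℕ))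
    (hlen : 2 ^ (t + u) ≤ Ys.length * 2 ^ u + Zs.length)
    (hYs : ∀ Y ∈ Ys, Constructible k d Y) (hZs : ∀ Z ∈ Zs, Constructible k d Z)
    (h : Ys.sum.map (· + t) + Zs.sum.map (· + (t + u)) ≤ X) (hX : X.card ≤ d) :
    Constructible k d X := by
  induction t generalizing Ys Zs X with
  | zero =>
    obtain _ | ⟨Y, Ys⟩ := Ys
    · exact of_list Zs (t := u) (by simpa using hlen) hZs (by simpa using h) hX
    · refine (hYs Y (by simp)).mono (le_trans ?_ h)
      simp only [List.sum_cons, add_zero, Multiset.map_id', add_assoc]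
      exact Multiset.le_add_right _ _
  | succ t ih =>
    have hpow : 2 ^ (t + 1 + u) = 2 ^ (t + u) + 2 ^ (t + u) := by ring
    have hpow' : 2 ^ (t + u) = 2 ^ t * 2 ^ u := pow_add 2 t u
    obtain ⟨Ys₁, Ys₂, Zs₁, Zs₂, rfl, rfl, h₁, h₂⟩ : ∃ Ys₁ Ys₂ Zs₁ Zs₂, Ys = Ys₁ ++ Ys₂ ∧
        Zs = Zs₁ ++ Zs₂ ∧ 2 ^ (t + u) ≤ Ys₁.length * 2 ^ u + Zs₁.length ∧
        2 ^ (t + u) ≤ Ys₂.length * 2 ^ u + Zs₂.length := by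
      -- Either one half is filled by `Ys` alone, or all of `Ys` goes into one half and is topped up
      -- with `Zs`.
      by_cases hc : 2 ^ t ≤ Ys.length
      · refine ⟨Ys.take (2 ^ t), Ys.drop (2 ^ t), [], Zs, by simp, by simp, ?_, ?_⟩
        · simp [List.length_take, hc, hpow']
        · rw [List.length_drop, Nat.sub_mul]
          omega
      · have : Ys.length * 2 ^ u ≤ 2 ^ t * 2 ^ u := Nat.mul_le_mul_right _ (by omega)
        refine ⟨Ys, [], Zs.take (2 ^ (t + u) - Ys.length * 2 ^ u),
          Zs.drop (2 ^ (t + u) - Ys.length * 2 ^ u), by simp, by simp, ?_, ?_⟩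
        · rw [List.length_take]; omega
        · rw [List.length_drop, List.length_nil]; omega
    have hsplit : (((Ys₁.sum.map (· + t) + Zs₁.sum.map (· + (t + u))) +
        (Ys₂.sum.map (· + t) + Zs₂.sum.map (· + (t + u)))).map (· + 1)) ≤ X := by
      refine le_of_eq_of_le ?_ h
      simp only [List.sum_append, Multiset.map_add, Multiset.map_map, Function.comp_def,
        add_assoc, add_comm u 1]
      abel
    have hcard := (Multiset.card_le_card hsplit).trans hX
    rw [Multiset.card_map, Multiset.card_add] at hcard
    simp only [List.mem_append] at hYs hZs
    exact of_split (ih Ys₁ Zs₁ h₁ (fun Y hY => hYs Y (.inl hY)) (fun Z hZ => hZs Z (.inl hZ))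
      le_rfl (by omega)) (ih Ys₂ Zs₂ h₂ (fun Y hY => hYs Y (.inr hY))
      (fun Z hZ => hZs Z (.inr hZ)) le_rfl (by omega)) hsplit hX

theorem replicate_two_pow {e : ℕ} (he : 2 ^ e ≤ d) :
    Constructible k d (Multiset.replicate (2 ^ e) e) := by
  refine of_list (t := e) (List.replicate (2 ^ e) {0}) (by simp) ?_ ?_ (by simpa using he)
  · intro Y hY
    rw [List.eq_of_mem_replicate hY]
    exact singleton_zero (Nat.one_le_two_pow.trans he)
  · simp [List.sum_replicate, Multiset.nsmul_singleton]

end Constructible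

/-! ### Groups of leaves and halving. -/

/-- For every pair `(e, δ)` in `H`, a group of `2 ^ e` leaves at depth `e + δ`. -/
def blocks (H : Multiset (ℕ × ℕ)) : Multiset ℕ :=
  H.bind fun g => Multiset.replicate (2 ^ g.1) (g.1 + g.2)

theorem blocks_add (H H' : Multiset (ℕ × ℕ)) : blocks (H + H') = blocks H + blocks H' :=
  Multiset.add_bind _ _ _

theorem blocks_cons (g : ℕ × ℕ) (H : Multiset (ℕ × ℕ)) :
    blocks (g ::ₘ H) = Multiset.replicate (2 ^ g.1) (g.1 + g.2) + blocks H :=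
  Multiset.cons_bind _ _ _

theorem blocks_mono {H H' : Multiset (ℕ × ℕ)} (h : H ≤ H') : blocks H ≤ blocks H' := by
  obtain ⟨u, rfl⟩ := Multiset.le_iff_exists_add.1 h
  rw [blocks_add]
  exact Multiset.le_add_right _ _

/-- Moving the groups of `blocks H` one level up and halving their sizes. -/
theorem blocks_eq_of_pos {H : Multiset (ℕ × ℕ)} (h : ∀ g ∈ H, 1 ≤ g.1) :
    blocks H = (blocks (H.map fun g => (g.1 - 1, g.2)) +
      blocks (H.map fun g => (g.1 - 1, g.2))).map (· + 1) := by
  induction H using Multiset.induction_on with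
  | empty => simp [blocks]
  | cons g H ih =>
    obtain ⟨e, δ⟩ := g
    have he : 1 ≤ e := h (e, δ) (by simp)
    obtain ⟨e, rfl⟩ := Nat.exists_eq_add_of_le' he
    rw [blocks_cons, Multiset.map_cons, blocks_cons,
      ih fun g hg => h g (Multiset.mem_cons_of_mem hg)]
    simp only [Multiset.map_add, Multiset.map_replicate, Nat.add_sub_cancel, pow_succ, mul_two,
      Multiset.replicate_add, add_right_comm e 1 δ]
    abel

theorem map_blocks {E : Multiset ℕ} {δ t : ℕ} :
    (blocks (E.map (·, δ))).map (· + t) = blocks (E.map (·, δ + t)) := by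
  simp [blocks, Multiset.bind_map, Multiset.map_bind, add_assoc]

/-- Halving `s` times. After every halving there is room for `2 ^ (D - 1)` new leaves. -/
theorem Constructible.of_halving {k D μ : ℕ} (hk : k = D + μ) {s : ℕ} (hs : s ≤ D)
    {H : Multiset (ℕ × ℕ)} (hH : ∀ g ∈ H, s ≤ g.1) (hcard : (blocks H).card ≤ 2 ^ D)
    (h : (blocks (H.map (fun g => (g.1 - s, g.2)) +
        (Multiset.range s).map fun i => (D - 1 - i, μ))).card ≤ 2 ^ D →
      Constructible k (2 ^ D) (blocks (H.map (fun g => (g.1 - s, g.2)) +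
        (Multiset.range s).map fun i => (D - 1 - i, μ)))) :
    Constructible k (2 ^ D) (blocks H) := by
  induction s generalizing H with
  | zero => simpa [hcard] using h
  | succ s ih =>
    obtain ⟨D, rfl⟩ := Nat.exists_eq_add_of_le' (Nat.one_le_of_lt hs)
    have hpos : ∀ g ∈ H, 1 ≤ g.1 := fun g hg => (Nat.le_add_left 1 s).trans (hH g hg)
    set H₁ : Multiset (ℕ × ℕ) := H.map fun g => (g.1 - 1, g.2) with hH₁
    have hblocks : blocks H = (blocks H₁ + blocks H₁).map (· + 1) := blocks_eq_of_pos hpos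
    have hcard₁ : (blocks H₁).card + (blocks H₁).card ≤ 2 ^ (D + 1) := by
      rwa [hblocks, Multiset.card_map, Multiset.card_add] at hcard
    have hW : Constructible k (2 ^ (D + 1)) (blocks ((D, μ) ::ₘ H₁)) := by
      refine ih (by omega) ?_ ?_ ?_
      · intro g hg
        rcases Multiset.mem_cons.1 hg with rfl | hg
        · show s ≤ D
          omega
        · obtain ⟨g, hg', rfl⟩ := Multiset.mem_map.1 hg
          have := hH g hg'
          show s ≤ g.1 - 1
          omega
      · rw [blocks_cons, Multiset.card_add, Multiset.card_replicate]
        show 2 ^ D + _ ≤ _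
        rw [pow_succ] at hcard₁ ⊢
        omega
      · have e : ((D, μ) ::ₘ H₁).map (fun g => (g.1 - s, g.2)) +
            (Multiset.range s).map (fun i => (D + 1 - 1 - i, μ)) =
            H.map (fun g => (g.1 - (s + 1), g.2)) +
              (Multiset.range (s + 1)).map fun i => (D + 1 - 1 - i, μ) := by
          simp only [hH₁, Multiset.map_cons, Multiset.map_map, Function.comp_def,
            Multiset.range_succ, Nat.sub_sub, add_comm 1 s, Nat.add_sub_cancel,
            Multiset.cons_add, Multiset.add_cons]
        rw [e]
        exact h
    -- The new leaves have depth `k - 1` in each child, hence depth `k` here, and drop out of the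
    -- count.
    refine of_children hW hW ?_ hcard
    rw [blocks_cons, hblocks]
    simp only [Multiset.map_add, Multiset.filter_add, Multiset.map_replicate]
    have hnew : (Multiset.replicate (2 ^ D) (D + μ + 1)).filter (· < k) = 0 := by
      rw [Multiset.filter_eq_nil]
      intro i hi
      have := Multiset.eq_of_mem_replicate hi
      omega
    rw [hnew, zero_add]
    exact add_le_add (Multiset.filter_le _ _) (Multiset.filter_le _ _)


theorem two_pow_le_card_blocks {H : Multiset (ℕ × ℕ)} {g : ℕ × ℕ} (hg : g ∈ H) :
    2 ^ g.1 ≤ (blocks H).card := by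
  obtain ⟨H', rfl⟩ := Multiset.exists_cons_of_mem hg
  rw [blocks_cons, Multiset.card_add, Multiset.card_replicate]
  exact Nat.le_add_right _ _

theorem sum_map_blocks (ls : List (Multiset ℕ)) (δ : ℕ) :
    (ls.map fun B => blocks (B.map (·, δ))).sum = blocks (ls.sum.map (·, δ)) := by
  induction ls with
  | nil => simp [blocks]
  | cons B ls ih => rw [List.map_cons, List.sum_cons, ih, List.sum_cons, Multiset.map_add,
      blocks_add]

theorem Multiset.exists_list_card_eq {α : Type*} (c f : ℕ) (M : Multiset α)
    (h : c * f ≤ M.card) :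
    ∃ ls : List (Multiset α), ls.length = c ∧ (∀ B ∈ ls, B.card = f) ∧ ls.sum ≤ M := by
  classical
  induction c generalizing M with
  | zero => exact ⟨[], by simp⟩
  | succ c ih =>
    rw [Nat.succ_mul] at h
    obtain ⟨B, hB, hBf⟩ : ∃ B ≤ M, B.card = f := by
      refine ⟨(M.toList.take f : List α), ?_, ?_⟩
      · conv_rhs => rw [← Multiset.coe_toList M]
        exact Multiset.coe_le.2 (List.take_sublist _ _).subperm
      · rw [Multiset.coe_card, List.length_take, Multiset.length_toList]
        omega
    obtain ⟨ls, h1, h2, h3⟩ := ih (M - B) (by rw [Multiset.card_sub hB]; omega)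
    refine ⟨B :: ls, by simp [h1], by simpa [hBf] using h2, ?_⟩
    rw [List.sum_cons]
    exact (add_le_add le_rfl h3).trans (add_tsub_cancel_of_le hB).le

/-! ### The table of sufficient numbers of groups for powers of two. -/

/-- In the situation `k = 2 ^ m` and `d = 2 ^ (2 ^ m - 1 - m)`, any `n` groups of size at least
`2 ^ (j * 2 ^ (m - 4))`, each of which would make up a complete binary tree three levels further
down, are constructible. -/
def GroupsSuffice (m j n : ℕ) : Prop :=
  ∀ E : Multiset ℕ, E.card = n → (∀ e ∈ E, j * 2 ^ (m - 4) ≤ e) →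
    (blocks (E.map (·, 3))).card ≤ 2 ^ (2 ^ m - 1 - m) →
    Constructible (2 ^ m) (2 ^ (2 ^ m - 1 - m)) (blocks (E.map (·, 3)))

theorem fifteen_mul_le {m : ℕ} (hm : 9 ≤ m) : 15 * 2 ^ (m - 4) ≤ 2 ^ m - 1 - m := by
  obtain ⟨r, rfl⟩ := Nat.exists_eq_add_of_le' hm
  have h1 : r < 2 ^ r := Nat.lt_two_pow_self
  have h2 : 2 ^ (r + 9) = 2 ^ r * 512 := pow_add 2 r 9
  have h3 : 2 ^ (r + 9 - 4) = 2 ^ r * 32 := pow_add 2 r 5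
  omega

/-- The halvings come in chunks of `2 ^ (m - 4) = 32 * 2 ^ (m - 9)`. Groups created in chunk `i`
have exponents at level at least `14 - i`, so they are cut into bundles of `f (14 - i)`. Where `f`
is `0`, division by zero yields no bundles. -/
theorem exists_bundles {m : ℕ} (hm : 9 ≤ m) (f : ℕ → ℕ) {j : ℕ} (hj : j ≤ 15) :
    ∃ ls : List (Multiset ℕ),
      ls.length = 2 ^ (m - 9) * ∑ i ∈ Finset.range j, 32 / f (14 - i) ∧
      ls.sum ≤ (Multiset.range (j * 2 ^ (m - 4))).map (2 ^ m - 1 - m - 1 - ·) ∧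
      ∀ B ∈ ls, ∃ j' < 15, 0 < f j' ∧ B.card = f j' ∧ ∀ e ∈ B, j' * 2 ^ (m - 4) ≤ e := by
  have hD := fifteen_mul_le hm
  have hL : 2 ^ (m - 4) = 2 ^ (m - 9) * 32 := by
    rw [show m - 4 = m - 9 + 5 by omega, pow_add]; norm_num
  generalize 2 ^ (m - 4) = L at hD hL ⊢
  generalize 2 ^ m - 1 - m = D at hD ⊢
  induction j with
  | zero => exact ⟨[], by simp⟩
  | succ j ih =>
    obtain ⟨ls, h1, h2, h3⟩ := ih (by omega)
    obtain ⟨ls', h1', h2', h3'⟩ := Multiset.exists_list_card_eq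
      (2 ^ (m - 9) * (32 / f (14 - j))) (f (14 - j))
      ((Multiset.range L).map fun r => D - 1 - (j * L + r)) (by
        rw [Multiset.card_map, Multiset.card_range, hL, mul_assoc]
        exact Nat.mul_le_mul_left _ (Nat.div_mul_le_self _ _))
    refine ⟨ls ++ ls', ?_, ?_, ?_⟩
    · rw [List.length_append, h1, h1', Finset.sum_range_succ, mul_add]
    · rw [List.sum_append, Nat.succ_mul, Multiset.range_add, Multiset.map_add, Multiset.map_map]
      exact add_le_add h2 h3'
    · intro B hB
      rcases List.mem_append.1 hB with hB | hB
      · exact h3 B hB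
      · refine ⟨14 - j, by omega, ?_, h2' B hB, fun e he => ?_⟩
        · rw [Nat.pos_iff_ne_zero]
          intro h0
          rw [h0, Nat.div_zero, mul_zero, List.length_eq_zero_iff] at h1'
          simp [h1'] at hB
        · have hle : B ≤ ls'.sum := List.single_le_sum (fun _ _ => Multiset.zero_le _) B hB
          obtain ⟨r, hr, rfl⟩ := Multiset.mem_map.1 (Multiset.mem_of_le (hle.trans h3') he)
          rw [Multiset.mem_range] at hr
          have : (14 - j) * L + j * L = 14 * L := by rw [← add_mul]; congr 1; omega
          omega

/-- After `j` chunks of halvings there are `2 ^ (m - 2)` slots at depth `m - 2`. Each old group is a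
complete tree at depth `3`, worth `2 ^ (m - 5)` slots; each bundle of new groups fills one. The
numerical hypothesis is this count divided by `2 ^ (m - 9)`. -/
theorem GroupsSuffice.of_table {m : ℕ} (hm : 9 ≤ m) {f : ℕ → ℕ}
    (hf : ∀ j < 15, 0 < f j → GroupsSuffice m j (f j)) {j n : ℕ} (hj : j ≤ 15)
    (h : 128 ≤ 16 * n + ∑ i ∈ Finset.range j, 32 / f (14 - i)) : GroupsSuffice m j n := by
  intro E hE hEj hcard
  have hD := fifteen_mul_le hm
  have hk : 2 ^ m = (2 ^ m - 1 - m) + (m + 1) := by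
    have : m < 2 ^ m := Nat.lt_two_pow_self
    omega
  refine Constructible.of_halving hk (s := j * 2 ^ (m - 4))
    ((Nat.mul_le_mul_right _ hj).trans hD) ?_ hcard fun hcap => ?_
  · intro g hg
    obtain ⟨e, he, rfl⟩ := Multiset.mem_map.1 hg
    exact hEj e he
  obtain ⟨ls, hlen, hsum, hls⟩ := exists_bundles hm f hj
  set s := j * 2 ^ (m - 4)
  set D := 2 ^ m - 1 - m
  set E' := E.map (· - s) with hE'
  set N := (Multiset.range s).map (D - 1 - ·) with hN
  have e1 : (E.map (·, 3)).map (fun g => (g.1 - s, g.2)) = E'.map (·, 3) := by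
    simp [hE']
  have e2 : (Multiset.range s).map (fun i => (D - 1 - i, m + 1)) = N.map (·, m + 1) := by
    simp [hN]
  rw [e1, e2] at hcap ⊢
  have hZ : ∀ B ∈ ls, B.map (·, m + 1) ≤ N.map (·, m + 1) := fun B hB =>
    Multiset.map_le_map ((List.single_le_sum (fun _ _ => Multiset.zero_le _) B hB).trans hsum)
  -- Seen from depth `m - 2`, the offset `m + 1` of a new group becomes `3`, as `GroupsSuffice`
  -- requires.
  have hm3 : 3 + (3 + (m - 5)) = m + 1 := by omega
  refine Constructible.of_two_lists (t := 3) (u := m - 5)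
    (E'.map fun e => Multiset.replicate (2 ^ e) e).toList
    (ls.map fun B => blocks (B.map (·, 3))) ?_ ?_ ?_ ?_ hcap
  · rw [Multiset.length_toList, Multiset.card_map, hE', Multiset.card_map, hE, List.length_map,
      hlen]
    obtain ⟨r, rfl⟩ := Nat.exists_eq_add_of_le' hm
    have h1 : 2 ^ (3 + (r + 9 - 5)) = 2 ^ r * 128 := by
      rw [show 3 + (r + 9 - 5) = r + 7 by omega, pow_add]; norm_num
    have h2 : 2 ^ (r + 9 - 5) = 2 ^ r * 16 := by
      rw [show r + 9 - 5 = r + 4 by omega, pow_add]; norm_num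
    rw [h1, h2, Nat.add_sub_cancel]
    calc 2 ^ r * 128 ≤ 2 ^ r * (16 * n + ∑ i ∈ Finset.range j, 32 / f (14 - i)) :=
          Nat.mul_le_mul_left _ h
      _ = _ := by ring
  · intro Y hY
    obtain ⟨e, he, rfl⟩ := Multiset.mem_map.1 (Multiset.mem_toList.1 hY)
    refine Constructible.replicate_two_pow (le_trans ?_ hcap)
    exact two_pow_le_card_blocks (g := (e, 3))
      (Multiset.mem_add.2 (.inl (Multiset.mem_map_of_mem _ he)))
  · intro Z hZm
    obtain ⟨B, hB, rfl⟩ := List.mem_map.1 hZm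
    obtain ⟨j', hj', hpos, hBc, hBe⟩ := hls B hB
    refine hf j' hj' hpos B hBc hBe ?_
    rw [← Multiset.card_map (· + (3 + (m - 5))), map_blocks, hm3]
    exact (Multiset.card_le_card (blocks_mono
      ((hZ B hB).trans (Multiset.le_add_left _ _)))).trans hcap
  · rw [Multiset.sum_toList, sum_map_blocks, map_blocks, hm3, blocks_add]
    refine add_le_add (le_of_eq ?_) (blocks_mono (Multiset.map_le_map hsum))
    have : (E'.map fun e => Multiset.replicate (2 ^ e) e).sum = blocks (E'.map (·, 0)) := by
      simp [blocks, Multiset.bind, Multiset.join]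
    rw [this, map_blocks, zero_add]

/-- The numbers of groups that suffice at the levels `0, …, 14` by `GroupsSuffice.of_table`, if the
numbers listed in `l` (where `0` stands for no information) do. -/
def improve (l : List ℕ) : List ℕ :=
  (List.range 15).map fun j => (143 - ∑ i ∈ Finset.range j, 32 / l.getD (14 - i) 0) / 16

theorem groupsSuffice_iterate_improve {m : ℕ} (hm : 9 ≤ m) (r : ℕ) {j : ℕ} (hj : j < 15)
    (h : 0 < (improve^[r] []).getD j 0) : GroupsSuffice m j ((improve^[r] []).getD j 0) := by
  induction r generalizing j with
  | zero => simp at h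
  | succ r ih =>
    refine GroupsSuffice.of_table hm (f := fun i => (improve^[r] []).getD i 0)
      (fun j hj h => ih hj h) hj.le ?_
    -- Since `143 = 128 + 15`, the entry is the deficit from `128` divided by `16`, rounded up.
    rw [Function.iterate_succ_apply', improve, List.getD_eq_getElem _ _ (by simpa using hj)]
    simp only [List.getElem_map, List.getElem_range]
    omega

theorem groupsSuffice_zero {m : ℕ} (hm : 9 ≤ m) : GroupsSuffice m 15 0 := by
  refine GroupsSuffice.of_table hm (f := fun i => (improve^[10] []).getD i 0)
    (fun j hj h => groupsSuffice_iterate_improve hm 10 hj h) le_rfl ?_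
  -- From the empty table, the first round gives `8` at every level; after ten rounds the bundles of
  -- all fifteen chunks supply the required `128` without any old group.
  decide +kernel

theorem exists_balanced_of_pow_two {m : ℕ} (hm : 9 ≤ m) :
    ∃ T : BinTree, T.Balanced (2 ^ m) (2 ^ (2 ^ m - 1)) [] := by
  obtain ⟨T, hT, h0⟩ := groupsSuffice_zero hm 0 rfl (by simp) (by simp [blocks])
  have hlt : m < 2 ^ m := Nat.lt_two_pow_self
  have e : 2 ^ m * 2 ^ (2 ^ m - 1 - m) = 2 ^ (2 ^ m - 1) := by
    rw [← pow_add]; congr 1; omega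
  refine ⟨T, e ▸ hT.balanced [] (by simp) fun i hi => ?_⟩
  by_contra hlt
  have : i ∈ T.depths.filter (· < 2 ^ m) := Multiset.mem_filter.2 ⟨hi, by simpa using hlt⟩
  simpa [blocks] using Multiset.mem_of_le h0 this

/-- The first conjunct says that `l(k)` is well defined, as a maximum that is attained. -/
theorem theorem1p11 :
    (∀ k : ℕ, 1 ≤ k → IsGreatest (satNeighborhoodBounds k) (maxSatNeighborhood k)) ∧
    (∃ K : ℕ, ∀ k : ℕ, K ≤ k → (∃ m : ℕ, k = 2 ^ m) →
      maxSatNeighborhood k ≤ 2 ^ (k - 1) - 1) ∧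
    (∀ k : ℕ, 3 ≤ k → maxSatNeighborhood k ≤ 2 ^ (k - 1) + 2 ^ (k - 2)) := by
  refine ⟨fun k hk => isGreatest_maxSatNeighborhood hk, ⟨2 ^ 9, ?_⟩, ?_⟩
  · rintro _ hk ⟨m, rfl⟩
    obtain ⟨T, hT⟩ := exists_balanced_of_pow_two ((Nat.pow_le_pow_iff_right one_lt_two).1 hk)
    exact Nat.le_sub_one_of_lt (hT.maxSatNeighborhood_lt Nat.one_le_two_pow)
  · intro k hk
    obtain ⟨n, rfl⟩ := Nat.exists_eq_add_of_le' (show 2 ≤ k by omega)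
    have h := (BinTree.balanced_three_levels n).maxSatNeighborhood_lt (by omega)
    have e : 2 ^ (n + 2 - 1) = 2 * 2 ^ n := pow_succ' 2 n
    rw [e, Nat.add_sub_cancel]
    omega
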